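/- Let $\mathbb{H}_1,\mathbb{H}_2$ be complex Hilbert spaces, let $\mathbb{L}(\mathbb{H}_1,\mathbb{H}_2)$ be the space of bounded linear operators from $\mathbb{H}_1$ to $\mathbb{H}_2$ with the operator norm, and let $\mathbb{K}(\mathbb{H}_1,\mathbb{H}_2)$ be its subspace of compact operators. Let $T\in \mathbb{L}(\mathbb{H}_1,\mathbb{H}_2)$ satisfy $\|T\|=1$ and $\operatorname{dist}(T,\mathbb{K}(\mathbb{H}_1,\mathbb{H}_2))=\inf\{\|T-K\|: K\in\mathbb{K}(\mathbb{H}_1,\mathbb{H}_2)\}<1$, and let $M_T=\{x\in\mathbb{H}_1:\|x\|=1,\ \|Tx\|=\|T\|\}$ be its norm attainment set. Then for every $A\in\mathbb{L}(\mathbb{H}_1,\mathbb{H}_2)$, $T$ is Birkhoff--James orthogonal to $A$ (written $T\perp_B A$), that is, $\|T+\lambda A\|\ge\|T\|$ for all $\lambda\in\mathbb{C}$, if and only if there exists $x\in M_T$ such that $Tx\perp Ax$, i.e. $\langle Tx,Ax\rangle=0$. -/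

import Mathlib

/-- Birkhoff–James orthogonality `x ⊥_B y` in a normed space over `𝕜`:
`‖x + c y‖ ≥ ‖x‖` for every scalar `c`. -/
def IsBirkhoffJamesOrthogonal (𝕜 : Type*) {E : Type*} [NormedField 𝕜]
    [SeminormedAddCommGroup E] [NormedSpace 𝕜 E] (x y : E) : Prop :=
  ∀ c : 𝕜, ‖x‖ ≤ ‖x + c • y‖

/-- The norm attainment set `M_T`: the unit vectors at which `T` attains its operator norm. -/
def normAttainmentSet {𝕜 E F : Type*} [NontriviallyNormedField 𝕜]
    [SeminormedAddCommGroup E] [NormedSpace 𝕜 E] [SeminormedAddCommGroup F] [NormedSpace 𝕜 F]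
    (T : E →L[𝕜] F) : Set E :=
  {x : E | ‖x‖ = 1 ∧ ‖T x‖ = ‖T‖}

open Filter Topology

/-! If `⟪T x, A x⟫ = 0` with `x` norm attaining, Pythagoras at `x` gives orthogonality. Conversely,
let `W` be the set of values `⟪T x, A x⟫` for `x` in the norm attainment set. Being at distance
below one from a compact operator makes maximizing sequences subconverge, so `W` is closed. Norm
attaining vectors are the unit sphere of a subspace, so `W` is convex by Toeplitz–Hausdorff. If `0 ∉
W`, some real functional is positive on `W`; but perturbing `T` in the corresponding direction `c •
A` yields, in the limit, a point of `W` where it is nonpositive. -/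

/-- A bounded operator of norm at most one which is at distance less than one from a compact
operator has the following compactness property: a sequence of unit vectors along which the norms
of the images tend to one has a convergent subsequence. -/
theorem exists_tendsto_subseq_of_tendsto_norm_apply {H₁ H₂ : Type*}
    [NormedAddCommGroup H₁] [InnerProductSpace ℂ H₁] [CompleteSpace H₁]
    [NormedAddCommGroup H₂] [InnerProductSpace ℂ H₂]
    {T K : H₁ →L[ℂ] H₂} (hT : ‖T‖ ≤ 1) (hK : IsCompactOperator K) (hTK : ‖T - K‖ < 1)
    {x : ℕ → H₁} (hx : ∀ n, ‖x n‖ = 1) (hTx : Tendsto (fun n => ‖T (x n)‖) atTop (𝓝 1)) :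
    ∃ y : H₁, ∃ φ : ℕ → ℕ, StrictMono φ ∧ Tendsto (x ∘ φ) atTop (𝓝 y) := by
  have hc : IsCompact (closure (K '' Metric.closedBall 0 1)) :=
    hK.isCompact_closure_image_closedBall 1
  obtain ⟨z, -, φ, hφ, hz⟩ := hc.tendsto_subseq (x := fun n => K (x n)) fun n =>
    subset_closure ⟨x n, by simp [hx n], rfl⟩
  have hTφ : Tendsto (fun n => ‖T (x (φ n))‖) atTop (𝓝 1) := hTx.comp hφ.tendsto_atTop
  have hKdist : Tendsto (fun p : ℕ × ℕ => ‖K (x (φ p.1)) - K (x (φ p.2))‖) atTop (𝓝 0) := by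
    have := cauchySeq_iff_tendsto_dist_atTop_0.1 hz.cauchySeq
    simpa only [dist_eq_norm, Function.comp] using this
  set r := ‖T - K‖ with hr
  have hr0 : 0 ≤ r := norm_nonneg _
  have hr1 : 0 < 1 - r ^ 2 := by nlinarith
  -- The parallelogram law for `u, v` and for `T u, T v`, with `‖T u + T v‖ ≤ ‖u + v‖`, bounds `‖u -
  -- v‖ ^ 2` by `4 - 2‖T u‖ ^ 2 - 2‖T v‖ ^ 2 + ‖T u - T v‖ ^ 2`. The last term contributes `r ^ 2 *
  -- ‖u - v‖ ^ 2`, absorbed on the left since `r < 1`.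
  have bound : ∀ p : ℕ × ℕ, ‖x (φ p.1) - x (φ p.2)‖ ^ 2 ≤
      ((2 - 2 * ‖T (x (φ p.1))‖ ^ 2) + (2 - 2 * ‖T (x (φ p.2))‖ ^ 2) +
        4 * ‖K (x (φ p.1)) - K (x (φ p.2))‖ + ‖K (x (φ p.1)) - K (x (φ p.2))‖ ^ 2)
        / (1 - r ^ 2) := by
    rintro ⟨m, n⟩
    dsimp only
    generalize hu : x (φ m) = u
    generalize hv : x (φ n) = v
    have hu1 : ‖u‖ = 1 := hu ▸ hx _
    have hv1 : ‖v‖ = 1 := hv ▸ hx _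
    have p1 := parallelogram_law_with_norm ℂ u v
    have p2 := parallelogram_law_with_norm ℂ (T u) (T v)
    have h1 : ‖T u + T v‖ ≤ ‖u + v‖ := by
      rw [← map_add]
      simpa using T.le_of_opNorm_le hT (u + v)
    have h2 : ‖T u - T v‖ ≤ r * ‖u - v‖ + ‖K u - K v‖ := by
      have e : T u - T v = (T - K) (u - v) + (K u - K v) := by
        simp only [sub_apply, map_sub]; abel
      rw [e]
      exact (norm_add_le _ _).trans (by gcongr; exact (T - K).le_opNorm _)
    have h3 : ‖u - v‖ ≤ 2 := (norm_sub_le _ _).trans (by linarith)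
    have h1' : ‖T u + T v‖ ^ 2 ≤ ‖u + v‖ ^ 2 := by gcongr
    have h2' : ‖T u - T v‖ ^ 2 ≤ (r * ‖u - v‖ + ‖K u - K v‖) ^ 2 := by gcongr
    have h4 : r * ‖u - v‖ ≤ 2 := by
      nlinarith [norm_nonneg (u - v)]
    have h5 := mul_le_mul_of_nonneg_right h4 (norm_nonneg (K u - K v))
    rw [hu1, hv1] at p1
    rw [le_div_iff₀ hr1]
    nlinarith
  have lim : Tendsto (fun p : ℕ × ℕ => ‖x (φ p.1) - x (φ p.2)‖ ^ 2) atTop (𝓝 0) := by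
    refine squeeze_zero (fun _ => sq_nonneg _) bound ?_
    have a1 : Tendsto (fun p : ℕ × ℕ => ‖T (x (φ p.1))‖) atTop (𝓝 1) := by
      rw [← prod_atTop_atTop_eq]; exact hTφ.comp tendsto_fst
    have a2 : Tendsto (fun p : ℕ × ℕ => ‖T (x (φ p.2))‖) atTop (𝓝 1) := by
      rw [← prod_atTop_atTop_eq]; exact hTφ.comp tendsto_snd
    have := ((((((a1.pow 2).const_mul 2).const_sub 2).add
      (((a2.pow 2).const_mul 2).const_sub 2)).add (hKdist.const_mul 4)).add
      (hKdist.pow 2)).div_const (1 - r ^ 2)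
    simpa using this
  have hcau : CauchySeq (x ∘ φ) := by
    rw [cauchySeq_iff_tendsto_dist_atTop_0]
    have := lim.sqrt
    simpa only [dist_eq_norm, Function.comp, Real.sqrt_sq (norm_nonneg _), Real.sqrt_zero] using this
  obtain ⟨y, hy⟩ := cauchySeq_tendsto_of_complete hcau
  exact ⟨y, φ, hφ, hy⟩

/-- A limit of unit vectors whose images have norms tending to the operator norm lies in the norm
attainment set. -/
theorem mem_normAttainmentSet_of_tendsto {H₁ H₂ : Type*}
    [NormedAddCommGroup H₁] [NormedSpace ℂ H₁] [NormedAddCommGroup H₂] [NormedSpace ℂ H₂]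
    {T : H₁ →L[ℂ] H₂} {x : ℕ → H₁} {y : H₁} (hx : ∀ n, ‖x n‖ = 1)
    (hTx : Tendsto (fun n => ‖T (x n)‖) atTop (𝓝 ‖T‖)) (hy : Tendsto x atTop (𝓝 y)) :
    y ∈ normAttainmentSet T := by
  refine ⟨tendsto_nhds_unique hy.norm (by simp [hx]), ?_⟩
  exact tendsto_nhds_unique ((T.continuous.tendsto y).comp hy).norm hTx

/-- If `T` has norm one and distance less than one from a compact operator, the image of its norm
attainment set under `x ↦ ⟪T x, A x⟫` is closed. -/
theorem isClosed_image_inner_normAttainmentSet {H₁ H₂ : Type*}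
    [NormedAddCommGroup H₁] [InnerProductSpace ℂ H₁] [CompleteSpace H₁]
    [NormedAddCommGroup H₂] [InnerProductSpace ℂ H₂]
    {T K : H₁ →L[ℂ] H₂} (hT : ‖T‖ = 1) (hK : IsCompactOperator K) (hTK : ‖T - K‖ < 1)
    (A : H₁ →L[ℂ] H₂) :
    IsClosed ((fun x => inner ℂ (T x) (A x)) '' normAttainmentSet T) := by
  refine IsSeqClosed.isClosed fun w z hw hz => ?_
  choose x hx hxw using hw
  have hTx : Tendsto (fun n => ‖T (x n)‖) atTop (𝓝 1) := by
    simp [fun n => (hx n).2, hT]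
  obtain ⟨y, φ, hφ, hy⟩ :=
    exists_tendsto_subseq_of_tendsto_norm_apply hT.le hK hTK (fun n => (hx n).1) hTx
  refine ⟨y, mem_normAttainmentSet_of_tendsto (fun n => (hx (φ n)).1)
    (by rw [hT]; exact hTx.comp hφ.tendsto_atTop) hy, ?_⟩
  refine tendsto_nhds_unique ?_ (hz.comp hφ.tendsto_atTop)
  have hcont : Continuous fun x => inner ℂ (T x) (A x) := by fun_prop
  refine ((hcont.tendsto y).comp hy).congr fun n => ?_
  simp [hxw]

/-- The norm attainment set of an operator of norm one is the unit sphere of the eigenspace of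
`T† T` for the eigenvalue one. -/
theorem mem_normAttainmentSet_iff_adjoint_apply {H₁ H₂ : Type*}
    [NormedAddCommGroup H₁] [InnerProductSpace ℂ H₁] [CompleteSpace H₁]
    [NormedAddCommGroup H₂] [InnerProductSpace ℂ H₂] [CompleteSpace H₂]
    {T : H₁ →L[ℂ] H₂} (hT : ‖T‖ = 1) {x : H₁} :
    x ∈ normAttainmentSet T ↔ ‖x‖ = 1 ∧ T.adjoint (T x) = x := by
  refine and_congr_right fun hx => ?_
  have key : inner ℂ (T.adjoint (T x)) x = (‖T x‖ : ℂ) ^ 2 := by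
    rw [ContinuousLinearMap.adjoint_inner_left, inner_self_eq_norm_sq_to_K]; rfl
  constructor
  · intro h
    have h1 : ‖T.adjoint (T x)‖ ≤ 1 := by
      have := T.adjoint.le_opNorm (T x)
      rwa [LinearIsometryEquiv.norm_map, h, hT, one_mul] at this
    -- Expanding gives `‖T†T x - x‖ ^ 2 ≤ 1 - 2 + 1 = 0`.
    have h2 := norm_sub_sq (𝕜 := ℂ) (T.adjoint (T x)) x
    rw [key, h, hT, hx] at h2
    norm_num at h2
    have h3 : ‖T.adjoint (T x) - x‖ = 0 := by
      nlinarith [norm_nonneg (T.adjoint (T x)), norm_nonneg (T.adjoint (T x) - x)]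
    exact sub_eq_zero.1 (norm_eq_zero.1 h3)
  · intro h
    rw [h, inner_self_eq_norm_sq_to_K, hx] at key
    have h2 : ‖T x‖ ^ 2 = 1 ^ 2 := Complex.ofReal_injective (by push_cast; exact key.symm)
    rw [hT]
    exact (pow_left_inj₀ (norm_nonneg _) zero_le_one two_ne_zero).1 h2

/-- The Toeplitz–Hausdorff theorem: the numerical range of `x ↦ ⟪T x, A x⟫` on the unit sphere of
a subspace is convex. -/
theorem convex_image_inner_sphere {H₁ H₂ : Type*}
    [NormedAddCommGroup H₁] [InnerProductSpace ℂ H₁]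
    [NormedAddCommGroup H₂] [InnerProductSpace ℂ H₂]
    (T A : H₁ →L[ℂ] H₂) (E : Submodule ℂ H₁) :
    Convex ℝ ((fun x => inner ℂ (T x) (A x)) '' {x : H₁ | ‖x‖ = 1 ∧ x ∈ E}) := by
  rw [convex_iff_segment_subset]
  rintro _ ⟨x, ⟨hx, hxE⟩, rfl⟩ _ ⟨y, ⟨hy, hyE⟩, rfl⟩
  dsimp only
  generalize ha : inner ℂ (T x) (A x) = a
  generalize hb : inner ℂ (T y) (A y) = b
  by_cases hab : a = b
  · subst hab
    rw [segment_same]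
    rintro _ rfl
    exact ⟨x, ⟨hx, hxE⟩, ha⟩
  have hba : b - a ≠ 0 := sub_ne_zero.2 (Ne.symm hab)
  -- the normalized form, with value `0` at `x` and `1` at `y`
  set B : H₁ → H₁ → ℂ := fun u v => (inner ℂ (T u) (A v) - a * inner ℂ u v) / (b - a) with hB
  have hBx : B x x = 0 := by simp [hB, ha, hx]
  have hBy : B y y = 1 := by simp [hB, hb, hy, div_self hba]
  have hBaddl : ∀ (s t : ℂ) (u v : H₁), B (s • u + t • v) (s • u + t • v) =
      (starRingEnd ℂ s * s) * B u u + starRingEnd ℂ s * t * B u v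
        + starRingEnd ℂ t * s * B v u + (starRingEnd ℂ t * t) * B v v := by
    intro s t u v
    simp only [hB, map_add, map_smul, inner_add_left, inner_add_right, inner_smul_left,
      inner_smul_right]
    ring
  -- choose a phase making the cross term real
  obtain ⟨c, hc, hcim⟩ : ∃ c : ℂ, ‖c‖ = 1 ∧
      (c * B x y + starRingEnd ℂ c * B y x).im = 0 := by
    set p := B x y - starRingEnd ℂ (B y x) with hp
    have e : ∀ c : ℂ, (c * B x y + starRingEnd ℂ c * B y x).im = (c * p).im := by
      intro c
      simp [hp, Complex.mul_im]
      ring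
    by_cases hp0 : p = 0
    · exact ⟨1, by simp, by rw [e, hp0]; simp⟩
    · refine ⟨starRingEnd ℂ p / ‖p‖, ?_, ?_⟩
      · simp [hp0]
      · rw [e, div_mul_eq_mul_div, ← Complex.normSq_eq_conj_mul_self, ← Complex.ofReal_div]
        exact Complex.ofReal_im _
  set d : ℝ := (c * B x y + starRingEnd ℂ c * B y x).re with hd
  have hcross : c * B x y + starRingEnd ℂ c * B y x = (d : ℂ) := by
    apply Complex.ext <;> simp [hd, hcim]
  have hcc : starRingEnd ℂ c * c = 1 := by
    rw [← Complex.normSq_eq_conj_mul_self, Complex.normSq_eq_norm_sq, hc]; norm_num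
  -- The form is real along this path from `x` to `c • y`, so after normalization the intermediate
  -- value theorem reaches every value in `[0, 1]`.
  set γ : ℝ → H₁ := fun t => ((1 - t : ℝ) : ℂ) • x + ((t : ℂ) * c) • y with hγ
  have hBγ : ∀ t : ℝ, B (γ t) (γ t) = (((1 - t) * t * d + t ^ 2 : ℝ) : ℂ) := by
    intro t
    rw [hγ, hBaddl, hBx, hBy]
    simp only [map_mul, Complex.conj_ofReal]
    push_cast
    rw [← hcross]
    linear_combination (t : ℂ) ^ 2 * hcc
  -- A zero would make `x` a unimodular multiple of `y`, forcing `a = b`.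
  have hγ0 : ∀ t : ℝ, γ t ≠ 0 := by
    intro t h0
    have hxy : ((1 - t : ℝ) : ℂ) • x = -(((t : ℂ) * c) • y) := eq_neg_of_add_eq_zero_left h0
    have hn : |1 - t| = |t| := by
      have := congrArg norm hxy
      rw [norm_neg, norm_smul, norm_smul, norm_mul, hc, hx, hy] at this
      simpa only [Complex.norm_real, Real.norm_eq_abs, mul_one] using this
    have ht : t = 1 / 2 := by
      rcases abs_eq_abs.1 hn with h | h <;> linarith
    have hxcy : x = -(c • y) := by
      subst ht
      have := congrArg (fun v => (2 : ℂ) • v) hxy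
      simp only [smul_neg, smul_smul, ← mul_assoc] at this
      norm_num at this
      exact this
    apply hba
    have h1 : a = b := by
      rw [← ha, ← hb, hxcy]
      simp only [map_neg, map_smul, inner_neg_neg, inner_smul_left, inner_smul_right]
      linear_combination inner ℂ (T y) (A y) * hcc
    rw [h1, sub_self]
  have hγc : Continuous γ := by
    simp only [hγ]; fun_prop
  have hgc : ContinuousOn (fun t : ℝ => ((1 - t) * t * d + t ^ 2) / ‖γ t‖ ^ 2) (Set.Icc 0 1) := by
    refine (Continuous.div (by fun_prop) (by fun_prop) fun t => ?_).continuousOn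
    exact pow_ne_zero _ (norm_ne_zero_iff.2 (hγ0 t))
  rw [segment_eq_image']
  rintro _ ⟨θ, hθ, rfl⟩
  have hγ1 : ‖γ 1‖ = 1 := by simp [hγ, norm_smul, hc, hy]
  obtain ⟨t, -, ht⟩ := intermediate_value_Icc zero_le_one hgc
    (show θ ∈ Set.Icc _ _ by simpa [hγ1] using hθ)
  dsimp only at ht
  have hn : ‖γ t‖ ≠ 0 := norm_ne_zero_iff.2 (hγ0 t)
  refine ⟨((‖γ t‖⁻¹ : ℝ) : ℂ) • γ t, ⟨?_, ?_⟩, ?_⟩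
  · rw [norm_smul, Complex.norm_real, norm_inv, norm_norm, inv_mul_cancel₀ hn]
  · exact E.smul_mem _ (E.add_mem (E.smul_mem _ hxE) (E.smul_mem _ hyE))
  · have hBt := hBγ t
    rw [div_eq_iff (pow_ne_zero 2 hn)] at ht
    rw [ht, hB] at hBt
    dsimp only at hBt
    rw [div_eq_iff hba, inner_self_eq_norm_sq_to_K] at hBt
    have hn' : (‖γ t‖ : ℂ) ≠ 0 := by exact_mod_cast hn
    simp only [map_smul, inner_smul_left, inner_smul_right, Complex.conj_ofReal, Complex.real_smul]
    push_cast at hBt ⊢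
    field_simp
    change _ - a * (‖γ t‖ : ℂ) ^ 2 = _ at hBt
    linear_combination hBt

/-- Birkhoff–James orthogonality `T ⊥_B A` yields, in each direction `c`, a norm attaining vector
at which the first order variation of the norm is nonnegative. -/
theorem IsBirkhoffJamesOrthogonal.exists_re_mul_inner_nonneg {H₁ H₂ : Type*}
    [NormedAddCommGroup H₁] [InnerProductSpace ℂ H₁] [CompleteSpace H₁]
    [NormedAddCommGroup H₂] [InnerProductSpace ℂ H₂]
    {T K A : H₁ →L[ℂ] H₂} (h : IsBirkhoffJamesOrthogonal ℂ T A)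
    (hT : ‖T‖ = 1) (hK : IsCompactOperator K) (hTK : ‖T - K‖ < 1) (c : ℂ) :
    ∃ x ∈ normAttainmentSet T, 0 ≤ (c * inner ℂ (T x) (A x)).re := by
  set t : ℕ → ℝ := fun n => 1 / ((n : ℝ) + 1) with ht
  have ht0 : ∀ n, 0 < t n := fun n => by simp only [ht]; positivity
  have ht1 : ∀ n, t n ≤ 1 := fun n => by
    simp only [ht]; rw [div_le_one (by positivity)]; linarith [Nat.cast_nonneg (α := ℝ) n]
  have htl : Tendsto t atTop (𝓝 0) := tendsto_one_div_add_atTop_nhds_zero_nat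
  -- The slack `t n ^ 2` is `o(t n)`, so it vanishes in the limit after the first order term is
  -- divided by `t n`.
  have hex : ∀ n, ∃ x : H₁, ‖x‖ = 1 ∧ 1 - t n ^ 2 < ‖T x + ((t n : ℂ) * c) • A x‖ := by
    intro n
    by_contra! hcon
    have h1 := h ((t n : ℂ) * c)
    have h2 : ‖T + ((t n : ℂ) * c) • A‖ ≤ 1 - t n ^ 2 :=
      ContinuousLinearMap.opNorm_le_of_unit_norm (by nlinarith [ht0 n, ht1 n]) hcon
    rw [hT] at h1
    nlinarith [pow_pos (ht0 n) 2]
  choose x hx hxn using hex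
  set C := ‖c‖ * ‖A‖ with hC
  have hAx : ∀ n, ‖c • A (x n)‖ ≤ C := fun n => by
    rw [norm_smul, hC]; gcongr; exact A.unit_le_opNorm _ (hx n).le
  have hTle : ∀ n, ‖T (x n)‖ ≤ 1 := fun n => hT ▸ T.unit_le_opNorm _ (hx n).le
  have hTge : ∀ n, 1 - t n ^ 2 - t n * C ≤ ‖T (x n)‖ := fun n => by
    have h1 := (hxn n).le.trans (norm_add_le _ _)
    rw [mul_smul, norm_smul, Complex.norm_real, Real.norm_of_nonneg (ht0 n).le] at h1
    have := mul_le_mul_of_nonneg_left (hAx n) (ht0 n).le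
    linarith
  have hTx : Tendsto (fun n => ‖T (x n)‖) atTop (𝓝 1) := by
    refine tendsto_of_tendsto_of_tendsto_of_le_of_le ?_ tendsto_const_nhds hTge hTle
    simpa using ((htl.pow 2).const_sub 1).sub (htl.mul_const C)
  have hre : ∀ n, -(t n * (1 + C ^ 2 / 2)) ≤ (c * inner ℂ (T (x n)) (A (x n))).re := by
    intro n
    have h1 := norm_add_sq (𝕜 := ℂ) (T (x n)) ((t n : ℂ) • (c • A (x n)))
    rw [← mul_smul, inner_smul_right, mul_assoc] at h1
    have h2 : RCLike.re ((t n : ℂ) * (c * inner ℂ (T (x n)) (A (x n))))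
        = t n * (c * inner ℂ (T (x n)) (A (x n))).re := Complex.re_ofReal_mul _ _
    rw [h2, mul_smul, norm_smul (t n : ℂ), Complex.norm_real, Real.norm_of_nonneg (ht0 n).le,
      ← mul_smul] at h1
    have h3 : (1 - t n ^ 2) ^ 2 ≤ ‖T (x n) + ((t n : ℂ) * c) • A (x n)‖ ^ 2 :=
      pow_le_pow_left₀ (by nlinarith [ht0 n, ht1 n]) (hxn n).le 2
    have h4 : ‖T (x n)‖ ^ 2 ≤ 1 := pow_le_one₀ (norm_nonneg _) (hTle n)
    have h5 : (t n * ‖c • A (x n)‖) ^ 2 ≤ t n ^ 2 * C ^ 2 := by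
      rw [mul_pow]; gcongr; exact hAx n
    have h6 : 0 ≤ t n * (2 * ((c * inner ℂ (T (x n)) (A (x n))).re + t n * (1 + C ^ 2 / 2))) := by
      nlinarith [sq_nonneg (t n ^ 2)]
    linarith [nonneg_of_mul_nonneg_right h6 (ht0 n)]
  obtain ⟨y, φ, hφ, hy⟩ := exists_tendsto_subseq_of_tendsto_norm_apply hT.le hK hTK hx hTx
  refine ⟨y, mem_normAttainmentSet_of_tendsto (fun n => hx (φ n))
    (by rw [hT]; exact hTx.comp hφ.tendsto_atTop) hy, ?_⟩
  have hcont : Continuous fun x => (c * inner ℂ (T x) (A x)).re := by fun_prop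
  have hl : Tendsto (fun n => -(t (φ n) * (1 + C ^ 2 / 2))) atTop (𝓝 0) := by
    simpa using ((htl.comp hφ.tendsto_atTop).mul_const (1 + C ^ 2 / 2)).neg
  exact le_of_tendsto_of_tendsto' hl ((hcont.tendsto y).comp hy) fun n => hre (φ n)

theorem mainTheorem3 {H₁ H₂ : Type*}
    [NormedAddCommGroup H₁] [InnerProductSpace ℂ H₁] [CompleteSpace H₁]
    [NormedAddCommGroup H₂] [InnerProductSpace ℂ H₂] [CompleteSpace H₂]
    (T : H₁ →L[ℂ] H₂) (hT : ‖T‖ = 1)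
    (hdist : Metric.infDist T {K : H₁ →L[ℂ] H₂ | IsCompactOperator K} < 1)
    (A : H₁ →L[ℂ] H₂) :
    IsBirkhoffJamesOrthogonal ℂ T A ↔
      ∃ x ∈ normAttainmentSet T, inner ℂ (T x) (A x) = 0 := by
  constructor
  · intro h
    obtain ⟨K, hK, hTK⟩ := (Metric.infDist_lt_iff ⟨0, isCompactOperator_zero⟩).1 hdist
    rw [dist_eq_norm] at hTK
    by_contra! hcon
    set W := (fun x => inner ℂ (T x) (A x)) '' normAttainmentSet T with hW
    have hclosed : IsClosed W := isClosed_image_inner_normAttainmentSet hT hK hTK A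
    have hconvex : Convex ℝ W := by
      have := convex_image_inner_sphere T A
        (LinearMap.eqLocus (T.adjoint ∘L T : H₁ →L[ℂ] H₁).toLinearMap LinearMap.id)
      convert this using 2
      ext x
      exact mem_normAttainmentSet_iff_adjoint_apply hT
    have h0 : (0 : ℂ) ∉ W := by
      rintro ⟨x, hx, hx0⟩
      exact hcon x hx hx0
    obtain ⟨f, u, hfu, hfW⟩ := geometric_hahn_banach_point_closed hconvex hclosed h0
    rw [map_zero] at hfu
    -- This `c` is chosen so that `(c * z).re = -f z`.
    obtain ⟨x, hx, hxre⟩ := h.exists_re_mul_inner_nonneg hT hK hTK ⟨-f 1, f Complex.I⟩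
    have h1 := hfW _ ⟨x, hx, rfl⟩
    dsimp only at h1
    generalize inner ℂ (T x) (A x) = z at h1 hxre
    have hz : f z = z.re * f 1 + z.im * f Complex.I := by
      conv_lhs => rw [show z = z.re • (1 : ℂ) + z.im • Complex.I by
        simp [Complex.re_add_im]]
      rw [map_add, map_smul, map_smul, smul_eq_mul, smul_eq_mul]
    rw [Complex.mul_re] at hxre
    dsimp only at hxre
    linarith
  · rintro ⟨x, ⟨hx, hTx⟩, horth⟩ c
    have h1 := norm_add_sq (𝕜 := ℂ) (T x) (c • A x)
    rw [inner_smul_right, horth, mul_zero, map_zero] at h1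
    have h2 : ‖T x‖ ≤ ‖T x + c • A x‖ :=
      le_of_sq_le_sq (by nlinarith [sq_nonneg ‖c • A x‖]) (norm_nonneg _)
    rw [← hTx]
    exact h2.trans ((T + c • A).unit_le_opNorm x hx.le)
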